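/- Let $(X,\|\cdot\|)$ be a real uniformly convex Banach space whose dual space $X^*$ is strictly convex. Let $J\in C^1(X,\mathbb{R})$ have compact derivative, i.e. the map $J':X\to X^*$ is continuous and sends bounded sets to relatively compact sets. Let $\mu\in C^1(X,\mathbb{R})$ be nonnegative, convex and coercive (that is, $\mu(x)\to+\infty$ as $\|x\|\to\infty$), and suppose that its derivative $\mu':X\to X^*$ admits a continuous inverse $X^*\to X$. Fix $\widetilde{x}\in X$ and $r>0$, and assume that: (B.2) $\displaystyle\inf_{x\in X}J(x)<\inf_{\mu(x)\le r}J(x)$; (B.3) $\mu(\widetilde{x})<r$ and $\displaystyle J(\widetilde{x})<\inf_{\mu(x)=r}J(x)$; (B.4) $J$ is bounded from below on $X$, i.e. there exists $C\in\mathbb{R}$ such that $J(x)\ge C$ for every $x\in X$. Then there exists a nonempty open set $A\subseteq(0,+\infty)$ such that for every $\lambda\in A$ the functional $\mu+\lambda J$ has at least three critical points in $X$. -/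

import Mathlib

open Set Filter

/-- A functional on a normed space is coercive if it tends to `+∞` as `‖x‖ → ∞`. -/
def IsCoerciveFunctional {X : Type*} [NormedAddCommGroup X] (f : X → ℝ) : Prop :=
  Tendsto f (Bornology.cobounded X) atTop

/-- A (possibly nonlinear) map between normed spaces is compact if it is continuous and maps
bounded sets to relatively compact sets. -/
def IsCompactMap {X Y : Type*} [NormedAddCommGroup X] [NormedAddCommGroup Y]
    (f : X → Y) : Prop :=
  Continuous f ∧ ∀ S : Set X, Bornology.IsBounded S → IsCompact (closure (f '' S))

/-- A map admits a continuous inverse if it has a two-sided inverse, defined on the whole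
target space, that is continuous. -/
def AdmitsContinuousInverse {X Y : Type*} [TopologicalSpace X] [TopologicalSpace Y]
    (f : X → Y) : Prop :=
  ∃ g : Y → X, Continuous g ∧ Function.LeftInverse g f ∧ Function.RightInverse g f

/-- The critical points of a functional: the points where it is differentiable with zero
Fréchet derivative. -/
def criticalPoints {X : Type*} [NormedAddCommGroup X] [NormedSpace ℝ X] (f : X → ℝ) : Set X :=
  {x | HasFDerivAt f (0 : StrongDual ℝ X) x}

/-! Choose `y` and `k` with `J y < k ≤ J` on `{μ ≤ r}`. For `lam > μ y / (k - J y)`, the value of `f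
= μ + lam * J` at `y` is below `lam * k ≤ f` on `{μ ≤ r}`, so a global minimizer lies in `{μ > r}`.
On `{μ = r}`, `f` is at least `r + lam * m`, which exceeds `f x₀`; hence the minimum over `{μ ≤ r}`
is attained inside, at a second critical point. Every path joining the two minimizers crosses `{μ =
r}`, and `mountain_pass` yields a third critical point, at a higher level. Attainment and the
minimax both rest on `exists_ekeland` and on the Palais–Smale condition, proved in
`palaisSmale_add_mul`. -/

open Topology

/-! ### Ekeland's principle -/

/-- Ekeland's variational principle. -/
theorem exists_ekeland {α : Type*} [MetricSpace α] [CompleteSpace α] {φ : α → ℝ}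
    (hφ : LowerSemicontinuous φ) {C : ℝ} (hC : ∀ x, C ≤ φ x) (a : α) {ε : ℝ} (hε : 0 < ε) :
    ∃ x, φ x ≤ φ a ∧ ∀ y, φ x ≤ φ y + ε * dist x y := by
  -- Membership in `T x` is a partial order; the point sought is minimal for it.
  set T : α → Set α := fun x => {y | φ y + ε * dist x y ≤ φ x} with hT
  have hTself : ∀ x, x ∈ T x := fun x => by simp [hT]
  have hTtrans : ∀ {x y z}, y ∈ T x → z ∈ T y → z ∈ T x := by
    intro x y z hy hz
    simp only [hT, mem_ofPred_eq] at *
    nlinarith [dist_triangle x y z]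
  have hTclosed : ∀ x, IsClosed (T x) := fun x => by
    have h : LowerSemicontinuous fun y => φ y + ε * dist x y :=
      hφ.add (Continuous.lowerSemicontinuous (by fun_prop))
    exact h.isClosed_preimage (φ x)
  have step : ∀ (n : ℕ) (x : α), ∃ y ∈ T x, ∀ z ∈ T x, φ y ≤ φ z + 1 / ((n : ℝ) + 1) := by
    intro n x
    have hbdd : BddBelow (φ '' T x) := ⟨C, by rintro _ ⟨y, -, rfl⟩; exact hC y⟩
    have hne : (φ '' T x).Nonempty := ⟨_, x, hTself x, rfl⟩
    obtain ⟨_, ⟨y, hy, rfl⟩, hlt⟩ := exists_lt_of_csInf_lt hne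
      (show sInf (φ '' T x) < sInf (φ '' T x) + 1 / ((n : ℝ) + 1) by
        linarith [Nat.one_div_pos_of_nat (α := ℝ) (n := n)])
    exact ⟨y, hy, fun z hz => by linarith [csInf_le hbdd ⟨z, hz, rfl⟩]⟩
  choose next hnext hnext_le using step
  let u : ℕ → α := fun n => Nat.rec a (fun n x => next n x) n
  have hu : ∀ n, u (n + 1) = next n (u n) := fun n => rfl
  have hmem : ∀ n m, n ≤ m → u m ∈ T (u n) := by
    intro n m hnm
    induction m, hnm using Nat.le_induction with
    | base => exact hTself _
    | succ m _ ih => exact hTtrans ih (hu m ▸ hnext m (u m))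
  have hlim0 : Tendsto (fun n : ℕ => 1 / ((n : ℝ) + 1)) atTop (𝓝 0) :=
    tendsto_one_div_add_atTop_nhds_zero_nat
  -- The index is shifted because near-minimality holds for `u (n + 1)`, chosen in `T (u n)`, but
  -- not for `u 0 = a`.
  have hcauchy : CauchySeq fun n => u (n + 1) := by
    refine cauchySeq_of_le_tendsto_0' (fun n : ℕ => 1 / ((n : ℝ) + 1) / ε) ?_
      (by simpa using hlim0.div_const ε)
    intro n m hnm
    have h1 : φ (u (m + 1)) + ε * dist (u (n + 1)) (u (m + 1)) ≤ φ (u (n + 1)) :=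
      hmem (n + 1) (m + 1) (by omega)
    have h2 := hnext_le n (u n) _ (hmem n (m + 1) (by omega))
    rw [← hu] at h2
    rw [le_div_iff₀ hε]
    linarith
  obtain ⟨x, hx⟩ := cauchySeq_tendsto_of_complete hcauchy
  have hxT : ∀ n, x ∈ T (u n) := fun n =>
    (hTclosed (u n)).mem_of_tendsto hx
      (eventually_atTop.2 ⟨n, fun m hm => hmem n (m + 1) (by omega)⟩)
  have hle : ∀ n, φ x ≤ φ (u n) := fun n => by
    have h : φ x + ε * dist (u n) x ≤ φ (u n) := hxT n
    nlinarith [dist_nonneg (x := u n) (y := x)]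
  refine ⟨x, hle 0, fun y => ?_⟩
  by_contra! hy
  have h : φ x ≤ φ y + 0 := ge_of_tendsto' (hlim0.const_add (φ y)) fun n => by
    have h2 := hnext_le n (u n) y (hTtrans (hxT n) hy.le)
    rw [← hu] at h2
    exact (hle (n + 1)).trans h2
  nlinarith [dist_nonneg (x := x) (y := y)]

/-! ### Palais–Smale condition and constrained minimization -/

section PalaisSmale

variable {X : Type*} [NormedAddCommGroup X] [NormedSpace ℝ X]

/-- The Palais–Smale condition: every sequence along which `f` is bounded and `f'` tends to zero
has a convergent subsequence. -/
def PalaisSmale (f : X → ℝ) : Prop :=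
  ∀ u : ℕ → X, (∃ C, ∀ n, |f (u n)| ≤ C) → Tendsto (fun n => fderiv ℝ f (u n)) atTop (𝓝 0) →
    ∃ (x : X) (φ : ℕ → ℕ), StrictMono φ ∧ Tendsto (u ∘ φ) atTop (𝓝 x)

theorem PalaisSmale.exists_fderiv_eq_zero {f : X → ℝ} (hf : ContDiff ℝ 1 f) (hPS : PalaisSmale f)
    {u : ℕ → X} {C : ℝ} (hC : ∀ n, |f (u n)| ≤ C)
    (hu : ∀ n : ℕ, ‖fderiv ℝ f (u n)‖ ≤ 1 / ((n : ℝ) + 1)) :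
    ∃ (x : X) (φ : ℕ → ℕ), StrictMono φ ∧ Tendsto (u ∘ φ) atTop (𝓝 x) ∧ fderiv ℝ f x = 0 := by
  have hlim : Tendsto (fun n => fderiv ℝ f (u n)) atTop (𝓝 0) :=
    squeeze_zero_norm hu tendsto_one_div_add_atTop_nhds_zero_nat
  obtain ⟨x, φ, hφ, hx⟩ := hPS u ⟨C, hC⟩ hlim
  refine ⟨x, φ, hφ, hx, ?_⟩
  exact tendsto_nhds_unique (((hf.continuous_fderiv one_ne_zero).tendsto x).comp hx)
    (hlim.comp hφ.tendsto_atTop)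

theorem exists_apply_lt_neg_of_lt_norm {L : StrongDual ℝ X} {ε : ℝ} (h : ε < ‖L‖) :
    ∃ v : X, ‖v‖ ≤ 1 ∧ L v < -ε := by
  obtain ⟨v, hv, hlt⟩ := L.exists_lt_apply_of_lt_opNorm h
  rcases lt_abs.1 (Real.norm_eq_abs (L v) ▸ hlt) with h' | h'
  · exact ⟨-v, by simpa using hv.le, by simpa using h'⟩
  · exact ⟨v, hv.le, by linarith⟩

theorem norm_fderiv_le_of_eventually_le_add {f : X → ℝ} {x : X} (hf : DifferentiableAt ℝ f x)
    {ε : ℝ} (hε : 0 ≤ ε) (h : ∀ᶠ y in 𝓝 x, f x ≤ f y + ε * dist x y) : ‖fderiv ℝ f x‖ ≤ ε := by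
  by_contra! hlt
  obtain ⟨v, hv, hLv⟩ := exists_apply_lt_neg_of_lt_norm hlt
  obtain ⟨c, hc, hcL⟩ : ∃ c, 0 < c ∧ fderiv ℝ f x v < -ε - c :=
    ⟨(-ε - fderiv ℝ f x v) / 2, by linarith, by linarith⟩
  have hline : Tendsto (fun s : ℝ => x + s • v) (𝓝[>] 0) (𝓝 x) := by
    have h : Continuous fun s : ℝ => x + s • v := by fun_prop
    simpa using (h.tendsto 0).mono_left nhdsWithin_le_nhds
  obtain ⟨s, ⟨h1, h2⟩, hs⟩ := ((hline.eventually
    ((hf.hasFDerivAt.isLittleO.def hc).and h)).and self_mem_nhdsWithin).exists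
  replace hs : 0 < s := hs
  simp only [dist_self_add_right, add_sub_cancel_left, map_smul, smul_eq_mul, norm_smul,
    Real.norm_eq_abs, abs_of_pos hs] at h1 h2
  have h3 := (abs_le.1 h1).2
  have h4 : s * ‖v‖ ≤ s := mul_le_of_le_one_right hs.le hv
  have h5 := mul_le_mul_of_nonneg_left h4 hc.le
  have h6 := mul_le_mul_of_nonneg_left h4 hε
  have h7 := mul_lt_mul_of_pos_left hcL hs
  linarith

/-- Ekeland's principle on the complete space `S` gives a minimizing sequence below level `f x₀ <
b`, hence off the boundary, where almost-minimality forces a small derivative. -/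
theorem exists_isMinOn_interior [CompleteSpace X] {f : X → ℝ} (hf : ContDiff ℝ 1 f)
    (hPS : PalaisSmale f) {S : Set X} (hS : IsClosed S) {C : ℝ} (hC : ∀ x ∈ S, C ≤ f x)
    {x₀ : X} (hx₀ : x₀ ∈ S) {b : ℝ} (hb : f x₀ < b) (hbS : ∀ x ∈ S, x ∉ interior S → b ≤ f x) :
    ∃ x ∈ S, (∀ y ∈ S, f x ≤ f y) ∧ fderiv ℝ f x = 0 := by
  have hbdd : BddBelow (f '' S) := ⟨C, by rintro _ ⟨y, hy, rfl⟩; exact hC y hy⟩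
  have key : ∀ n : ℕ, ∃ x ∈ S, f x ≤ f x₀ ∧ f x ≤ sInf (f '' S) + 1 / ((n : ℝ) + 1) ∧
      ‖fderiv ℝ f x‖ ≤ 1 / ((n : ℝ) + 1) := by
    intro n
    have hpos : (0 : ℝ) < 1 / ((n : ℝ) + 1) := Nat.one_div_pos_of_nat
    obtain ⟨a, ha, ha₀, haI⟩ : ∃ a ∈ S, f a ≤ f x₀ ∧ f a ≤ sInf (f '' S) + 1 / ((n : ℝ) + 1) := by
      obtain ⟨_, ⟨y, hy, rfl⟩, hlt⟩ := exists_lt_of_csInf_lt (s := f '' S) ⟨_, x₀, hx₀, rfl⟩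
        (lt_add_of_pos_right _ hpos)
      rcases le_total (f y) (f x₀) with h | h
      · exact ⟨y, hy, h, hlt.le⟩
      · exact ⟨x₀, hx₀, le_rfl, h.trans hlt.le⟩
    have : CompleteSpace S := hS.completeSpace_coe
    obtain ⟨⟨x, hx⟩, hxa, hmin⟩ := exists_ekeland (φ := fun y : S => f y)
      (hf.continuous.comp continuous_subtype_val).lowerSemicontinuous
      (fun y => hC y y.2) ⟨a, ha⟩ hpos
    have hxa' : f x ≤ f a := hxa
    refine ⟨x, hx, hxa'.trans ha₀, hxa'.trans haI, ?_⟩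
    have hxint : x ∈ interior S := by
      by_contra hcon
      linarith [hbS x hx hcon]
    refine norm_fderiv_le_of_eventually_le_add (hf.differentiable one_ne_zero x) hpos.le ?_
    filter_upwards [mem_interior_iff_mem_nhds.1 hxint] with y hy using hmin ⟨y, hy⟩
  choose u huS hu₀ huI hu' using key
  obtain ⟨x, φ, hφ, hx, hx'⟩ := hPS.exists_fderiv_eq_zero hf (u := u) (C := max (f x₀) (-C))
    (fun n => abs_le.2 ⟨by linarith [le_max_right (f x₀) (-C), hC _ (huS n)],
      (hu₀ n).trans (le_max_left _ _)⟩) hu'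
  refine ⟨x, hS.mem_of_tendsto hx (Eventually.of_forall fun n => huS _), fun y hy => ?_, hx'⟩
  have h1 : Tendsto (fun n => f (u (φ n))) atTop (𝓝 (f x)) := (hf.continuous.tendsto x).comp hx
  have h2 : Tendsto (fun n => sInf (f '' S) + 1 / ((φ n : ℝ) + 1)) atTop
      (𝓝 (sInf (f '' S) + 0)) :=
    ((tendsto_one_div_add_atTop_nhds_zero_nat (𝕜 := ℝ)).comp hφ.tendsto_atTop).const_add _
  have h3 := le_of_tendsto_of_tendsto' h1 h2 fun n => huI (φ n)
  linarith [csInf_le hbdd ⟨y, hy, rfl⟩]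

/-! ### Minimax over paths -/

/-- If pushing the curve `γ` along `w` costs at least `-ε h` in the maximum of `f`, then the
derivative of `f` along `w` is at least `-ε` at some maximum point of `f ∘ γ`. -/
theorem exists_isMax_neg_le_fderiv {K : Type*} [TopologicalSpace K] [CompactSpace K] [Nonempty K]
    [FirstCountableTopology K] {f : X → ℝ} (hf : ContDiff ℝ 1 f) (γ w : C(K, X))
    (hw : ∀ t, ‖w t‖ ≤ 1) {ε : ℝ}
    (h : ∀ s : ℝ, 0 < s → ∃ t, ∀ t', f (γ t') ≤ f (γ t + s • w t) + ε * s) :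
    ∃ t, (∀ t', f (γ t') ≤ f (γ t)) ∧ -ε ≤ fderiv ℝ f (γ t) (w t) := by
  set s : ℕ → ℝ := fun n => 1 / ((n : ℝ) + 1)
  have hs : ∀ n, 0 < s n := fun n => Nat.one_div_pos_of_nat
  have hs0 : Tendsto s atTop (𝓝 0) := tendsto_one_div_add_atTop_nhds_zero_nat
  choose t ht using fun n => h (s n) (hs n)
  obtain ⟨t₀, φ, hφ, ht₀⟩ := CompactSpace.tendsto_subseq t
  have hsφ := hs0.comp hφ.tendsto_atTop
  have hγ := (γ.continuous.tendsto t₀).comp ht₀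
  have hwt := (w.continuous.tendsto t₀).comp ht₀
  have hsum : Tendsto (fun n => γ (t (φ n)) + s (φ n) • w (t (φ n))) atTop (𝓝 (γ t₀)) := by
    simpa using hγ.add (hsφ.smul hwt)
  refine ⟨t₀, fun t' => ?_, ?_⟩
  · have h1 : Tendsto (fun n => f (γ (t (φ n)) + s (φ n) • w (t (φ n))) + ε * s (φ n)) atTop
        (𝓝 (f (γ t₀) + ε * 0)) :=
      ((hf.continuous.tendsto _).comp hsum).add (hsφ.const_mul ε)
    simpa using ge_of_tendsto' h1 fun n => ht (φ n) t'
  · by_contra! hlt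
    set L := fderiv ℝ f (γ t₀)
    obtain ⟨c, hc, hcL⟩ : ∃ c, 0 < c ∧ L (w t₀) < -ε - c :=
      ⟨(-ε - L (w t₀)) / 2, by linarith, by linarith⟩
    -- Strict differentiability is needed because the base points `γ (t (φ n))` also move.
    have hstrict := (hf.contDiffAt.hasStrictFDerivAt (x := γ t₀) one_ne_zero).isLittleO.def hc
    have hev := (hsum.prodMk_nhds hγ).eventually hstrict
    have hLw := ((L.continuous.tendsto _).comp hwt).eventually (gt_mem_nhds hcL)
    obtain ⟨n, hn, hLn⟩ := (hev.and hLw).exists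
    simp only [Function.comp_apply, add_sub_cancel_left, map_smul, smul_eq_mul, norm_smul,
      Real.norm_eq_abs, abs_of_pos (hs (φ n))] at hn hLn
    have h1 := (abs_le.1 hn).2
    have h2 := ht (φ n) (t (φ n))
    have h3 := hs (φ n)
    have h4 : c * (s (φ n) * ‖w (t (φ n))‖) ≤ c * s (φ n) :=
      mul_le_mul_of_nonneg_left (mul_le_of_le_one_right h3.le (hw _)) hc.le
    have h5 := mul_lt_mul_of_pos_left hLn h3
    change f (γ (t (φ n)) + s (φ n) • w (t (φ n))) - f (γ (t (φ n))) -
      s (φ n) * L (w (t (φ n))) ≤ _ at h1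
    linarith

/-- Ekeland's principle is applied to the maximum of `f` along a path. If `f'` were large at every
maximum point of the almost optimal path, a descent field vanishing at the endpoints would lower
that maximum too fast. `M` does not depend on `ε`, as Palais–Smale requires. -/
theorem exists_le_and_norm_fderiv_le_of_linking [CompleteSpace X] {f : X → ℝ}
    (hf : ContDiff ℝ 1 f) {a b : X} {β : ℝ} (ha : f a < β) (hb : f b < β)
    (hβ : ∀ γ : C(unitInterval, X), γ 0 = a → γ 1 = b → ∃ t, β ≤ f (γ t)) :
    ∃ M, ∀ ε, 0 < ε → ∃ x, β ≤ f x ∧ f x ≤ M ∧ ‖fderiv ℝ f x‖ ≤ ε := by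
  let Γ : Set C(unitInterval, X) := {γ | γ 0 = a ∧ γ 1 = b}
  have hΓ : IsClosed Γ :=
    (isClosed_eq (continuous_eval_const 0) continuous_const).inter
      (isClosed_eq (continuous_eval_const 1) continuous_const)
  have : CompleteSpace Γ := hΓ.completeSpace_coe
  let Φ : Γ → ℝ := fun γ => ⨆ t, f (γ.1 t)
  have hcont : ∀ γ : C(unitInterval, X), Continuous fun t => f (γ t) := fun γ =>
    hf.continuous.comp γ.continuous
  have hbdd : ∀ γ : C(unitInterval, X), BddAbove (range fun t => f (γ t)) := fun γ =>
    (isCompact_range (hcont γ)).bddAbove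
  have hΦ : LowerSemicontinuous Φ := lowerSemicontinuous_ciSup (fun γ => hbdd γ.1) fun t =>
    (hf.continuous.comp
      ((continuous_eval_const t).comp continuous_subtype_val)).lowerSemicontinuous
  have hΦβ : ∀ γ, β ≤ Φ γ := fun γ => by
    obtain ⟨t, ht⟩ := hβ γ.1 γ.2.1 γ.2.2
    exact ht.trans (le_ciSup (hbdd γ.1) t)
  let γ₀ : Γ := ⟨⟨fun t => a + (t : ℝ) • (b - a), by fun_prop⟩, by simp [Γ]⟩
  refine ⟨Φ γ₀, fun ε hε => ?_⟩
  obtain ⟨⟨γ, hγ0, hγ1⟩, hγle, hγmin⟩ := exists_ekeland hΦ hΦβ γ₀ hε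
  set γ' : Γ := ⟨γ, hγ0, hγ1⟩
  by_contra! hcon
  set P : unitInterval → Prop := fun t => ∀ t', f (γ t') ≤ f (γ t)
  have hPΦ : ∀ t, P t → f (γ t) = Φ γ' := fun t ht =>
    le_antisymm (le_ciSup (hbdd γ) t) (ciSup_le ht)
  have hPclosed : IsClosed {t | P t} := by
    simp only [P, ofPred_forall]
    exact isClosed_iInter fun t' => isClosed_le continuous_const (hcont γ)
  have hP : ∀ t, P t → ε < ‖fderiv ℝ f (γ t)‖ := fun t ht =>
    hcon _ (hPΦ t ht ▸ hΦβ γ') (hPΦ t ht ▸ hγle)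
  have hP0 : ¬ P 0 := fun h => by
    have := hPΦ 0 h
    rw [hγ0] at this
    linarith [hΦβ γ']
  have hP1 : ¬ P 1 := fun h => by
    have := hPΦ 1 h
    rw [hγ1] at this
    linarith [hΦβ γ']
  have hdf : Continuous fun t => fderiv ℝ f (γ t) :=
    (hf.continuous_fderiv one_ne_zero).comp γ.continuous
  -- The constraints on `v` are convex, so local constant choices glue by a partition of unity.
  obtain ⟨w, hw⟩ := exists_continuous_forall_mem_convex_of_local_const
    (t := fun t => {v : X | ‖v‖ ≤ 1 ∧ (t = 0 ∨ t = 1 → v = 0) ∧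
      (P t → fderiv ℝ f (γ t) v < -ε)})
    (by
      intro t v hv v' hv' p q hp hq hpq
      refine ⟨?_, fun h => by simp [hv.2.1 h, hv'.2.1 h], fun h => ?_⟩
      · simpa using convex_closedBall (0 : X) 1 (by simpa using hv.1) (by simpa using hv'.1)
          hp hq hpq
      · exact convex_halfSpace_lt (fderiv ℝ f (γ t)).toLinearMap.isLinear (-ε)
          (hv.2.2 h) (hv'.2.2 h) hp hq hpq)
    (by
      intro t
      by_cases ht : P t
      · obtain ⟨v, hv, hlt⟩ := exists_apply_lt_neg_of_lt_norm (hP t ht)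
        have ht0 : t ≠ 0 := fun h => hP0 (h ▸ ht)
        have ht1 : t ≠ 1 := fun h => hP1 (h ▸ ht)
        refine ⟨v, ?_⟩
        filter_upwards [isOpen_ne.mem_nhds ht0, isOpen_ne.mem_nhds ht1,
          (hdf.clm_apply continuous_const).continuousAt.eventually (gt_mem_nhds hlt)]
          with s h0 h1 hs
        exact ⟨hv, fun h => (h.elim h0 h1).elim, fun _ => hs⟩
      · refine ⟨0, ?_⟩
        filter_upwards [hPclosed.isOpen_compl.mem_nhds ht] with s hs
        exact ⟨by simp, fun _ => rfl, fun h => (hs h).elim⟩)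
  obtain ⟨t, ht, hle⟩ := exists_isMax_neg_le_fderiv hf γ w (fun t => (hw t).1) (ε := ε) (by
    intro s hs
    let η : C(unitInterval, X) := γ + s • w
    have hη : η ∈ Γ := by
      constructor
      · simp [η, hγ0, (hw 0).2.1 (Or.inl rfl)]
      · simp [η, hγ1, (hw 1).2.1 (Or.inr rfl)]
    obtain ⟨t, -, ht⟩ := isCompact_univ.exists_isMaxOn univ_nonempty (hcont η).continuousOn
    refine ⟨t, fun t' => ?_⟩
    have hdist : dist γ η ≤ s := by
      refine (ContinuousMap.dist_le hs.le).2 fun t => ?_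
      simpa [η, dist_eq_norm, norm_smul, abs_of_pos hs] using
        mul_le_of_le_one_right hs.le (hw t).1
    have h1 : f (γ t') ≤ Φ γ' := le_ciSup (hbdd γ) t'
    have h2 : Φ ⟨η, hη⟩ ≤ f (η t) := ciSup_le fun t'' => ht (mem_univ t'')
    have h3 : Φ γ' ≤ Φ ⟨η, hη⟩ + ε * dist γ η := hγmin ⟨η, hη⟩
    have h4 := mul_le_mul_of_nonneg_left hdist hε.le
    change f (γ t') ≤ f (η t) + ε * s
    linarith)
  exact absurd ((hw t).2.2 ht) (not_lt.2 hle)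

/-- The mountain pass theorem. -/
theorem mountain_pass [CompleteSpace X] {f : X → ℝ} (hf : ContDiff ℝ 1 f) (hPS : PalaisSmale f)
    {a b : X} {β : ℝ} (ha : f a < β) (hb : f b < β)
    (hβ : ∀ γ : C(unitInterval, X), γ 0 = a → γ 1 = b → ∃ t, β ≤ f (γ t)) :
    ∃ x, β ≤ f x ∧ fderiv ℝ f x = 0 := by
  obtain ⟨M, hM⟩ := exists_le_and_norm_fderiv_le_of_linking hf ha hb hβ
  choose u hu₁ hu₂ hu₃ using fun n : ℕ => hM (1 / ((n : ℝ) + 1)) Nat.one_div_pos_of_nat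
  obtain ⟨x, φ, -, hx, hx'⟩ := hPS.exists_fderiv_eq_zero hf (u := u) (C := max M (-β))
    (fun n => abs_le.2 ⟨by linarith [le_max_right M (-β), hu₁ n],
      (hu₂ n).trans (le_max_left _ _)⟩) hu₃
  exact ⟨x, ge_of_tendsto' ((hf.continuous.tendsto x).comp hx) fun n => hu₁ (φ n), hx'⟩

/-! ### Palais–Smale for `μ + lam * J` -/

theorem palaisSmale_add_mul {J μ : X → ℝ} (hJ : ContDiff ℝ 1 J)
    (hJcompact : IsCompactMap (fun x => (fderiv ℝ J x : StrongDual ℝ X)))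
    (hμ : ContDiff ℝ 1 μ) (hμcoercive : IsCoerciveFunctional μ)
    (hμinv : AdmitsContinuousInverse (fun x => (fderiv ℝ μ x : StrongDual ℝ X)))
    {C : ℝ} (hC : ∀ x, C ≤ J x) {lam : ℝ} (hlam : 0 < lam) :
    PalaisSmale fun x => μ x + lam * J x := by
  intro u ⟨M, hM⟩ hu
  obtain ⟨g, hg, hgl, -⟩ := hμinv
  have hfderiv : ∀ x, fderiv ℝ (fun x => μ x + lam * J x) x =
      fderiv ℝ μ x + lam • fderiv ℝ J x := fun x =>
    ((hμ.differentiable one_ne_zero x).hasFDerivAt.add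
      ((hJ.differentiable one_ne_zero x).hasFDerivAt.const_mul lam)).fderiv
  have hbdd : Bornology.IsBounded (range u) := by
    have h := hμcoercive.eventually (eventually_gt_atTop (M - lam * C))
    refine Bornology.IsBounded.subset (t := {x | ¬ M - lam * C < μ x}) ?_ ?_
    · rw [← Bornology.isCobounded_compl_iff]
      simpa [compl_ofPred] using! h
    · rintro _ ⟨n, rfl⟩
      have h1 := (abs_le.1 (hM n)).2
      have h2 := mul_le_mul_of_nonneg_left (hC (u n)) hlam.le
      simp only [mem_ofPred_eq, not_lt]
      linarith
  obtain ⟨L, -, φ, hφ, hL⟩ := (hJcompact.2 _ hbdd).tendsto_subseq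
    (x := fun n => fderiv ℝ J (u n))
    (fun n => subset_closure (mem_image_of_mem _ (mem_range_self n)))
  -- Since `μ' + lam • J'` tends to `0` and `J'` to `L`, `μ'` tends to `-lam • L`; applying the
  -- inverse `g` recovers the points.
  refine ⟨g (0 - lam • L), φ, hφ, ?_⟩
  have h := (hu.comp hφ.tendsto_atTop).sub (hL.const_smul lam)
  refine ((hg.tendsto _).comp h).congr fun n => ?_
  simpa [hfderiv] using hgl (u (φ n))

end PalaisSmale

/-! ### Three critical points -/

theorem mainTheorem1 {X : Type*} [NormedAddCommGroup X] [NormedSpace ℝ X] [CompleteSpace X]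
    [UniformConvexSpace X] [StrictConvexSpace ℝ (StrongDual ℝ X)]
    (J μ : X → ℝ)
    (hJ : ContDiff ℝ 1 J)
    (hJcompact : IsCompactMap (fun x => (fderiv ℝ J x : StrongDual ℝ X)))
    (hμ : ContDiff ℝ 1 μ)
    (hμnonneg : ∀ x, 0 ≤ μ x)
    (hμconvex : ConvexOn ℝ univ μ)
    (hμcoercive : IsCoerciveFunctional μ)
    (hμinv : AdmitsContinuousInverse (fun x => (fderiv ℝ μ x : StrongDual ℝ X)))
    (x₀ : X) (r : ℝ) (hr : 0 < r)
    (hB2 : (⨅ x : X, (J x : EReal)) < ⨅ x ∈ {x : X | μ x ≤ r}, (J x : EReal))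
    (hB3 : μ x₀ < r ∧ (J x₀ : EReal) < ⨅ x ∈ {x : X | μ x = r}, (J x : EReal))
    (hB4 : ∃ C : ℝ, ∀ x, C ≤ J x) :
    ∃ A : Set ℝ, A.Nonempty ∧ IsOpen A ∧ A ⊆ Ioi 0 ∧
      ∀ lam ∈ A, 3 ≤ (criticalPoints (fun x => μ x + lam * J x)).encard := by

  obtain ⟨C, hC⟩ := hB4
  obtain ⟨hμx₀, hB3⟩ := hB3
  obtain ⟨m, hm, hm'⟩ := EReal.lt_iff_exists_real_btwn.1 hB3
  obtain ⟨k, hk, hk'⟩ := EReal.lt_iff_exists_real_btwn.1 hB2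
  obtain ⟨y, hy⟩ := iInf_lt_iff.1 hk
  replace hm : J x₀ < m := EReal.coe_lt_coe_iff.1 hm
  replace hy : J y < k := EReal.coe_lt_coe_iff.1 hy
  replace hm' : ∀ x, μ x = r → m ≤ J x := fun x hx =>
    EReal.coe_le_coe_iff.1 (hm'.le.trans (iInf₂_le x hx))
  replace hk' : ∀ x, μ x ≤ r → k ≤ J x := fun x hx =>
    EReal.coe_le_coe_iff.1 (hk'.le.trans (iInf₂_le x hx))
  refine ⟨Ioi (μ y / (k - J y)), nonempty_Ioi, isOpen_Ioi,
    Ioi_subset_Ioi (div_nonneg (hμnonneg y) (sub_pos.2 hy).le), fun lam hlam => ?_⟩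
  have hlam0 : 0 < lam := (div_nonneg (hμnonneg y) (sub_pos.2 hy).le).trans_lt hlam
  have hylam : μ y < lam * (k - J y) := (div_lt_iff₀ (sub_pos.2 hy)).1 hlam
  set f : X → ℝ := fun x => μ x + lam * J x with hfdef
  have hf : ContDiff ℝ 1 f := hμ.add (contDiff_const.mul hJ)
  have hPS : PalaisSmale f := palaisSmale_add_mul hJ hJcompact hμ hμcoercive hμinv hC hlam0
  have hfC : ∀ x, lam * C ≤ f x := fun x => by
    have := mul_le_mul_of_nonneg_left (hC x) hlam0.le
    simp only [hfdef]
    linarith [hμnonneg x]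
  have hfr : ∀ x, μ x = r → r + lam * m ≤ f x := fun x hx => by
    have := mul_le_mul_of_nonneg_left (hm' x hx) hlam0.le
    simp only [hfdef]
    linarith
  have hfx₀ : f x₀ < r + lam * m := by
    have := mul_lt_mul_of_pos_left hm hlam0
    simp only [hfdef]
    linarith
  obtain ⟨x₁, hx₁S, hx₁min, hx₁⟩ := exists_isMinOn_interior hf hPS (S := {x | μ x ≤ r})
    (isClosed_le hμ.continuous continuous_const) (fun x _ => hfC x) hμx₀.le hfx₀
    (fun x hx hxi => hfr x (le_antisymm hx (not_lt.1 fun hlt => hxi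
      (lt_subset_interior_le hμ.continuous continuous_const hlt))))
  obtain ⟨x₂, -, hx₂min, hx₂⟩ := exists_isMinOn_interior hf hPS isClosed_univ
    (fun x _ => hfC x) (mem_univ x₀) hfx₀ (fun x _ hxi => (hxi (by simp)).elim)
  have hx₁β : f x₁ < r + lam * m := (hx₁min x₀ hμx₀.le).trans_lt hfx₀
  have hx₂β : f x₂ < r + lam * m := (hx₂min x₀ (mem_univ _)).trans_lt hfx₀
  -- The choice of `lam` enters here: `f y < lam * k`.
  have hx₂r : r < μ x₂ := by
    by_contra! hle
    have h1 := mul_le_mul_of_nonneg_left (hk' x₂ hle) hlam0.le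
    have h2 : μ x₂ + lam * J x₂ ≤ μ y + lam * J y := hx₂min y (mem_univ _)
    linarith [hμnonneg x₂]
  have hx₁r : μ x₁ ≤ r := hx₁S
  obtain ⟨x₃, hx₃β, hx₃⟩ := mountain_pass hf hPS hx₁β hx₂β (fun γ h0 h1 => by
    obtain ⟨t, ht⟩ := mem_range_of_exists_le_of_exists_ge (hμ.continuous.comp γ.continuous)
      ⟨0, by simpa [h0] using hx₁r⟩ ⟨1, by simpa [h1] using hx₂r.le⟩
    exact ⟨t, hfr _ ht⟩)
  have hcrit : ∀ x, fderiv ℝ f x = 0 → x ∈ criticalPoints f := fun x hx => by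
    have h := (hf.differentiable one_ne_zero x).hasFDerivAt
    rwa [hx] at h
  have h12 : x₁ ≠ x₂ := by rintro rfl; linarith
  have h13 : x₁ ≠ x₃ := by rintro rfl; linarith
  have h23 : x₂ ≠ x₃ := by rintro rfl; linarith
  have hsub : ({x₁, x₂, x₃} : Set X) ⊆ criticalPoints f := by
    rintro x (rfl | rfl | rfl)
    exacts [hcrit _ hx₁, hcrit _ hx₂, hcrit _ hx₃]
  calc (3 : ℕ∞) = ({x₁, x₂, x₃} : Set X).encard :=
        (encard_eq_three.2 ⟨x₁, x₂, x₃, h12, h13, h23, rfl⟩).symm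
    _ ≤ _ := encard_le_encard hsub
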